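/- A weighted uncertainty matroid $(E,\mathcal I,A,w)$ consists of a finite matroid $M=(E,\mathcal I)$, for each $e\in E$ a non-empty uncertainty area $A_e\subset\mathbb R$ that is a finite union of bounded intervals, each of them open or closed, and a weight $w_e\in A_e$. Querying $e$ has a cost $c_e\ge 0$, which is part of the input. A minimum-weight basis (MWB) of $M$ with respect to weights $w'$ is a basis $B$ minimizing $\sum_{e\in B}w'_e$. A set $Q\subseteq E$ verifies an MWB $B$ of $(M,w)$ if $B$ is an MWB of $(M,w')$ for every $w'\in\prod_{e\in E}A_e$ with $w'_e=w_e$ for all $e\in Q$; in this case $Q$ is called a certificate. A minimum-cost certificate is a certificate $Q$ whose cost $\sum_{e\in Q}c_e$ is minimum among all sets that verify some MWB of $(M,w)$. **Theorem.** There is a polynomial-time algorithm that, given any weighted uncertainty matroid $(E,\mathcal I,A,w)$ with query costs $c$, computes an MWB $B$ of $(M,w)$ that is verified by some minimum-cost certificate. Here $M$ is given by an independence oracle whose queries are answered in time polynomial in $|E|$, and the areas are given by a list of intervals. The algorithm is a single program for a random access machine (natural-number registers and arrays, with addition, truncated subtraction and comparison); it accesses the real input numbers (weights, costs, interval endpoints)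 only by comparing two of them, in unit time, and its running time is at most a polynomial in $|E|$ plus the number of listed intervals. -/

import Mathlib

/-! ### Weighted uncertainty matroids and certificates -/

/-- A nonempty bounded real interval that is open or closed. A closed interval may be a point. -/
structure BddInterval where
  lower : ℝ
  upper : ℝ
  closed : Bool
  valid : if closed then lower ≤ upper else lower < upper

/-- The set of reals described by a bounded interval. -/
def BddInterval.toSet (I : BddInterval) : Set ℝ :=
  if I.closed then Set.Icc I.lower I.upper else Set.Ioo I.lower I.upper

/-- A nonempty finite union of bounded intervals, each of which is open or closed. -/
def IsUncertaintyArea (A : Set ℝ) : Prop :=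
  A.Nonempty ∧ ∃ l : List BddInterval, A = {x | ∃ I ∈ l, x ∈ I.toSet}

/-- An uncertainty matroid whose element set is the type `α` (finite wherever it is used). -/
structure UncertaintyMatroid (α : Type*) where
  matroid : Matroid α
  ground_eq : matroid.E = Set.univ
  area : α → Set ℝ
  area_isUncertaintyArea : ∀ e, IsUncertaintyArea (area e)

/-- A weighted uncertainty matroid together with the nonnegative costs of querying elements. -/
structure WeightedUncertaintyMatroid (α : Type*) extends UncertaintyMatroid α where
  weight : α → ℝ
  weight_mem : ∀ e, weight e ∈ area e
  cost : α → ℝ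
  cost_nonneg : ∀ e, 0 ≤ cost e

/-- `B` is a minimum-weight basis of the matroid `M` with weights `w`. -/
def IsMWB {α : Type*} (M : Matroid α) (w : α → ℝ) (B : Finset α) : Prop :=
  M.IsBase (B : Set α) ∧
    ∀ B' : Finset α, M.IsBase (B' : Set α) → ∑ e ∈ B, w e ≤ ∑ e ∈ B', w e

namespace WeightedUncertaintyMatroid

variable {α : Type*} (𝓜 : WeightedUncertaintyMatroid α)

/-- `w'` is a weight assignment that is consistent with (the queries of) `Q`. -/
def Consistent (Q : Finset α) (w' : α → ℝ) : Prop :=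
  (∀ e, w' e ∈ 𝓜.area e) ∧ ∀ e ∈ Q, w' e = 𝓜.weight e

/-- The query set `Q` is a certificate that verifies the minimum-weight basis `B`. -/
def Verifies (Q B : Finset α) : Prop :=
  IsMWB 𝓜.matroid 𝓜.weight B ∧ ∀ w' : α → ℝ, 𝓜.Consistent Q w' → IsMWB 𝓜.matroid w' B

/-- `Q` verifies some basis, and it is a cheapest set that does so. -/
def IsMinCostCertificate (Q : Finset α) : Prop :=
  (∃ B, 𝓜.Verifies Q B) ∧
    ∀ Q' B' : Finset α, 𝓜.Verifies Q' B' → ∑ e ∈ Q, 𝓜.cost e ≤ ∑ e ∈ Q', 𝓜.cost e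

end WeightedUncertaintyMatroid

/-! ### The machine model

A random access machine, written as a structured programming language. Its memory consists of
natural number registers and of arrays of natural numbers; the only arithmetic on them is addition
and truncated subtraction, so that after `t` steps every number has `O(t)` more bits than at the
start. Real numbers occur only in read-only input arrays, and the only operation on them is to
compare two entries. A set system is accessible only through an oracle. A run is thus also a run
of the same length on the unit-cost real RAM, and, when the input numbers are rational, it can be
simulated by an oracle Turing machine with polynomial overhead. -/

/-- What a program can access but not change: the real input arrays, the oracle, and the time that
the oracle needs for one answer. -/
structure Env where
  real : ℕ → ℕ → ℝ
  oracle : Set ℕ → Prop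
  oracleTime : ℕ

/-- The memory: register `r` holds `reg r`, entry `i` of array `a` is `arr a i`. -/
structure Memory where
  reg : ℕ → ℕ
  arr : ℕ → ℕ → ℕ

/-- Natural number expressions. -/
inductive Expr where
  | lit (k : ℕ)
  | reg (r : ℕ)
  | get (a : ℕ) (i : Expr)
  | add (x y : Expr)
  | sub (x y : Expr)

def Expr.eval (s : Memory) : Expr → ℕ
  | lit k => k
  | reg r => s.reg r
  | get a i => s.arr a (i.eval s)
  | add x y => x.eval s + y.eval s
  | sub x y => x.eval s - y.eval s

/-- The time to evaluate an expression: one step per operation. -/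
def Expr.time : Expr → ℕ
  | lit _ => 1
  | reg _ => 1
  | get _ i => 1 + i.time
  | add x y => 1 + x.time + y.time
  | sub x y => 1 + x.time + y.time

/-- Tests. `realLe a i b j` asks whether entry `i` of the real array `a` is at most entry `j` of
the real array `b`; `query a` asks the oracle about the set with indicator array `a`. -/
inductive Test where
  | le (x y : Expr)
  | realLe (a : ℕ) (i : Expr) (b : ℕ) (j : Expr)
  | query (a : ℕ)
  | not (p : Test)
  | and (p q : Test)

def Test.Holds (env : Env) (s : Memory) : Test → Prop
  | le x y => x.eval s ≤ y.eval s
  | realLe a i b j => env.real a (i.eval s) ≤ env.real b (j.eval s)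
  | query a => env.oracle {i | s.arr a i ≠ 0}
  | not p => ¬ p.Holds env s
  | and p q => p.Holds env s ∧ q.Holds env s

/-- The time to evaluate a test: one step per operation, plus the time of the oracle. -/
def Test.time (env : Env) : Test → ℕ
  | le x y => 1 + x.time + y.time
  | realLe _ i _ j => 1 + i.time + j.time
  | query _ => 1 + env.oracleTime
  | not p => 1 + p.time env
  | and p q => 1 + p.time env + q.time env

/-- Programs. `assign r x` sets register `r` to `x`; `store a i x` sets entry `i` of array `a`
to `x`. -/
inductive Program where
  | skip
  | assign (r : ℕ) (x : Expr)
  | store (a : ℕ) (i x : Expr)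
  | seq (P Q : Program)
  | ite (p : Test) (P Q : Program)
  | while (p : Test) (P : Program)

def Memory.setReg (s : Memory) (r v : ℕ) : Memory :=
  { s with reg := Function.update s.reg r v }

def Memory.setArr (s : Memory) (a i v : ℕ) : Memory :=
  { s with arr := Function.update s.arr a (Function.update (s.arr a) i v) }

/-- `Exec env P s s' t`: started in memory `s`, the program `P` halts in memory `s'` after time
exactly `t`. -/
inductive Exec (env : Env) : Program → Memory → Memory → ℕ → Prop where
  | skip (s) : Exec env .skip s s 1
  | assign (r x s) : Exec env (.assign r x) s (s.setReg r (x.eval s)) (1 + x.time)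
  | store (a i x s) :
      Exec env (.store a i x) s (s.setArr a (i.eval s) (x.eval s)) (1 + i.time + x.time)
  | seq {P Q s s' s'' t t'} : Exec env P s s' t → Exec env Q s' s'' t' →
      Exec env (.seq P Q) s s'' (t + t')
  | ite_true {p P Q s s' t} : p.Holds env s → Exec env P s s' t →
      Exec env (.ite p P Q) s s' (1 + p.time env + t)
  | ite_false {p P Q s s' t} : ¬ p.Holds env s → Exec env Q s s' t →
      Exec env (.ite p P Q) s s' (1 + p.time env + t)
  | while_true {p P s s' s'' t t'} : p.Holds env s → Exec env P s s' t →
      Exec env (.while p P) s' s'' t' →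
      Exec env (.while p P) s s'' (1 + p.time env + t + t')
  | while_false {p P s} : ¬ p.Holds env s → Exec env (.while p P) s s (1 + p.time env)

/-- Programs are deterministic: there is at most one halting run from each memory. -/
theorem Exec.deterministic {env : Env} {P : Program} {s s₁ s₂ : Memory} {t₁ t₂ : ℕ}
    (h₁ : Exec env P s s₁ t₁) (h₂ : Exec env P s s₂ t₂) : s₁ = s₂ ∧ t₁ = t₂ := by
  induction h₁ generalizing s₂ t₂ with
  | skip s => cases h₂; exact ⟨rfl, rfl⟩
  | assign r x s => cases h₂; exact ⟨rfl, rfl⟩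
  | store a i x s => cases h₂; exact ⟨rfl, rfl⟩
  | seq _ _ ih ih' =>
    cases h₂ with
    | seq h h' =>
      obtain ⟨rfl, rfl⟩ := ih h
      obtain ⟨rfl, rfl⟩ := ih' h'
      exact ⟨rfl, rfl⟩
  | ite_true hp _ ih =>
    cases h₂ with
    | ite_true _ h => obtain ⟨rfl, rfl⟩ := ih h; exact ⟨rfl, rfl⟩
    | ite_false hn _ => exact absurd hp hn
  | ite_false hn _ ih =>
    cases h₂ with
    | ite_true hp _ => exact absurd hp hn
    | ite_false _ h => obtain ⟨rfl, rfl⟩ := ih h; exact ⟨rfl, rfl⟩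
  | while_true hp _ _ ih ih' =>
    cases h₂ with
    | while_true _ h h' =>
      obtain ⟨rfl, rfl⟩ := ih h
      obtain ⟨rfl, rfl⟩ := ih' h'
      exact ⟨rfl, rfl⟩
    | while_false hn => exact absurd hp hn
  | while_false hn =>
    cases h₂ with
    | while_true hp _ _ => exact absurd hp hn
    | while_false _ => exact ⟨rfl, rfl⟩

/-! ### How instances are given to programs

The elements are numbered `0, …, n - 1`, and the uncertainty areas are given by one list of pairs
(element, interval), in any order: the area of `e` is the union of the intervals paired with `e`.
-/

namespace WeightedUncertaintyMatroid

/-- The list `pieces` describes the uncertainty areas of `𝓜`. -/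
def DescribedBy {n : ℕ} (𝓜 : WeightedUncertaintyMatroid (Fin n))
    (pieces : List (Fin n × BddInterval)) : Prop :=
  ∀ e, 𝓜.area e = {x | ∃ I, (e, I) ∈ pieces ∧ x ∈ I.toSet}

/-- The real arrays `0, 1, 2, 3` hold the weights, the query costs, and the lower and the upper
endpoints of the listed intervals (all further entries are `0`); the oracle is the independence
oracle. -/
noncomputable def env {n : ℕ} (𝓜 : WeightedUncertaintyMatroid (Fin n))
    (pieces : List (Fin n × BddInterval)) (oracleTime : ℕ) : Env where
  real a i :=
    match a with
    | 0 => if h : i < n then 𝓜.weight ⟨i, h⟩ else 0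
    | 1 => if h : i < n then 𝓜.cost ⟨i, h⟩ else 0
    | 2 => if h : i < pieces.length then pieces[i].2.lower else 0
    | 3 => if h : i < pieces.length then pieces[i].2.upper else 0
    | _ => 0
  oracle S := 𝓜.matroid.Indep {e | (e : ℕ) ∈ S}
  oracleTime := oracleTime

end WeightedUncertaintyMatroid

/-- Initially the registers `0, 1` hold the number of elements and the number of listed intervals,
the arrays `0, 1` hold, for each listed interval, its element and whether it is closed, and
everything else is `0`. -/
def initialMemory {n : ℕ} (pieces : List (Fin n × BddInterval)) : Memory where
  reg r :=
    match r with
    | 0 => n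
    | 1 => pieces.length
    | _ => 0
  arr a i :=
    match a with
    | 0 => if h : i < pieces.length then (pieces[i].1 : ℕ) else 0
    | 1 => if h : i < pieces.length then (if pieces[i].2.closed then 1 else 0) else 0
    | _ => 0

/-- The output is the set of elements whose entry in array `2` is nonzero. -/
def Memory.output (s : Memory) (n : ℕ) : Finset (Fin n) :=
  Finset.univ.filter fun e => s.arr 2 e ≠ 0

/-! By exchange, a basis `B` has minimum weight iff `w e ≤ w f` whenever `f ∉ B` and `e` lies on the
fundamental circuit of `f`. Hence verification is a condition on such pairs `(e, f)` only
(`verifies_iff`).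

Call an element untied if it is the unique heaviest element of a circuit or the unique lightest
element of a cocircuit; it then lies in no MWB or in every MWB. A tied element always has an
exchange partner of equal weight. A certificate for `B` must therefore query every tied `e ∈ B`
whose area reaches above its weight and every tied `e ∉ B` whose area reaches below it. Up to a term
common to all MWBs, the cost of these forced queries is `∑ e ∈ B, tiePrice e` (`sum_forcedTied`).

Let `B'` be a basis that is minimal for the lexicographic weight `(weight, tiePrice)`. If `Q`
verifies `B`, then the untied part of `Q` together with the forced queries of `B'` verifies `B'`, at
no greater cost (`exists_verifies_of_lex_minimal`). The proof moves bounds between the two bases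
using that a circuit and a cocircuit never meet in exactly one element. So `B'` is verified by a
minimum-cost certificate.

Such a `B'` is found by the greedy algorithm. Since `tiePrice e` is `0` or plus or minus the cost of
`e`, the order can be decided by comparing inputs (`key`, `lex_le_of_key_le`), and it is never
necessary to find out which elements are tied. -/

/-! ### Locally minimal bases -/

namespace Matroid

variable {α Γ : Type*} {M : Matroid α} {B B' C D : Set α} {e f : α}

lemma IsCircuit.exists_ne_mem_of_isCocircuit (hC : M.IsCircuit C) (hD : M.IsCocircuit D)
    (heC : e ∈ C) (heD : e ∈ D) : ∃ g ∈ C, g ∈ D ∧ g ≠ e := by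
  obtain ⟨g, ⟨hgC, hgD⟩, hge⟩ :=
    (hC.isCocircuit_inter_nontrivial hD ⟨e, heC, heD⟩).exists_ne e
  exact ⟨g, hgC, hgD, hge⟩

lemma mem_of_mem_fundCircuit_of_ne (he : e ∈ M.fundCircuit f B) (hne : e ≠ f) : e ∈ B :=
  (M.fundCircuit_subset_insert f B he).resolve_left hne

lemma mem_ground_sdiff_of_mem_fundCocircuit_of_ne (hf : f ∈ M.fundCocircuit e B)
    (hne : f ≠ e) : f ∈ M.E \ B :=
  (M.fundCocircuit_subset_insert_compl e B hf).resolve_left hne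

/-- A base that cannot be improved by exchanging a pair of elements. -/
def IsLocallyMinimalBase [LE Γ] (M : Matroid α) (w : α → Γ) (B : Set α) : Prop :=
  M.IsBase B ∧ ∀ f ∈ M.E \ B, ∀ e ∈ M.fundCircuit f B, w e ≤ w f

lemma IsLocallyMinimalBase.le_of_mem_fundCocircuit [Preorder Γ] {w : α → Γ}
    (h : M.IsLocallyMinimalBase w B) (hf : f ∈ M.fundCocircuit e B) : w e ≤ w f := by
  obtain rfl | hne := eq_or_ne f e
  · exact le_rfl
  exact h.2 f (mem_ground_sdiff_of_mem_fundCocircuit_of_ne hf hne) e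
    (h.1.mem_fundCocircuit_iff_mem_fundCircuit.1 hf)

lemma IsLocallyMinimalBase.comp_monotone {Δ : Type*} [Preorder Γ] [Preorder Δ] {w : α → Γ}
    {v : α → Δ} (h : M.IsLocallyMinimalBase w B) (hwv : ∀ e f, w e ≤ w f → v e ≤ v f) :
    M.IsLocallyMinimalBase v B :=
  ⟨h.1, fun f hf e he ↦ hwv _ _ (h.2 f hf e he)⟩

/-! ### Local and global minimality agree; the ordered group is arbitrary so that lexicographic
weights are covered. -/

section Sum

variable [AddCommGroup Γ] [LinearOrder Γ] [IsOrderedAddMonoid Γ]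

/-- Exchanging some `f ∈ B' \ B` for a suitable `e` on its fundamental circuit in `B` brings `B'`
closer to `B` without increasing its weight. -/
theorem IsLocallyMinimalBase.sum_le {w : α → Γ} {B B' : Finset α}
    (h : M.IsLocallyMinimalBase w (B : Set α)) (hB' : M.IsBase (B' : Set α)) :
    ∑ e ∈ B, w e ≤ ∑ e ∈ B', w e := by
  classical
  induction hk : (B' \ B).card using Nat.strong_induction_on generalizing B' with
  | _ k ih =>
  obtain h0 | ⟨f, hf⟩ := (B' \ B).eq_empty_or_nonempty
  · have : (B' : Set α) = B := hB'.eq_of_subset_isBase h.1 (by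
      exact_mod_cast Finset.sdiff_eq_empty_iff_subset.1 h0)
    rw [Finset.coe_inj.1 this]
  obtain ⟨hfB', hfB⟩ := Finset.mem_sdiff.1 hf
  have hfE : f ∈ M.E := hB'.subset_ground hfB'
  have hC := h.1.fundCircuit_isCircuit hfE (by exact_mod_cast hfB)
  -- If `B' \ {f}` spanned the rest of the circuit, it would span `f` too, against the independence
  -- of `B'`.
  obtain ⟨e, ⟨heC, hef⟩, he⟩ : ∃ e ∈ M.fundCircuit f B \ {f}, e ∉ M.closure (B' \ {f}) := by
    by_contra! hcl
    refine hB'.indep.notMem_closure_sdiff_of_mem (e := f) (by exact_mod_cast hfB') ?_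
    exact M.closure_subset_closure_of_subset_closure hcl
      (hC.mem_closure_sdiff_singleton_of_mem (M.mem_fundCircuit f B))
  have heB : e ∈ B := by exact_mod_cast mem_of_mem_fundCircuit_of_ne heC hef
  have heE : e ∈ M.E := h.1.subset_ground heB
  have heB' : e ∉ B' := fun heB' ↦ he (M.mem_closure_of_mem' ⟨by exact_mod_cast heB', hef⟩ heE)
  have hbase : M.IsBase ((insert e (B'.erase f) : Finset α) : Set α) := by
    have := hB'.exchange_base_of_notMem_closure (e := f) (by exact_mod_cast hfB') he heE
    simpa using this
  have hlt : (insert e (B'.erase f) \ B).card < k := by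
    rw [← hk]
    refine Finset.card_lt_card (Finset.ssubset_iff_of_subset ?_ |>.2 ⟨f, hf, ?_⟩)
    · intro x hx
      simp only [Finset.mem_sdiff, Finset.mem_insert, Finset.mem_erase] at hx ⊢
      obtain ⟨rfl | ⟨-, hx⟩, hxB⟩ := hx
      · exact absurd heB hxB
      · exact ⟨hx, hxB⟩
    · have : f ≠ e := fun h ↦ hef h.symm
      simp [this]
  have key := ih _ hlt hbase rfl
  rw [Finset.sum_insert (by simp [heB'])] at key
  rw [← Finset.add_sum_erase _ _ hfB']
  exact key.trans (by gcongr; exact h.2 f ⟨hfE, by exact_mod_cast hfB⟩ e heC)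

theorem IsBase.isLocallyMinimalBase_of_sum_le {w : α → Γ} {B : Finset α}
    (hB : M.IsBase (B : Set α))
    (h : ∀ B' : Finset α, M.IsBase (B' : Set α) → ∑ e ∈ B, w e ≤ ∑ e ∈ B', w e) :
    M.IsLocallyMinimalBase w (B : Set α) := by
  classical
  refine ⟨hB, fun f ⟨hfE, hfB⟩ e he ↦ ?_⟩
  obtain rfl | hef := eq_or_ne e f
  · exact le_rfl
  have heB : e ∈ B := by exact_mod_cast mem_of_mem_fundCircuit_of_ne he hef
  have hfB' : f ∉ B := by exact_mod_cast hfB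
  have hbase : M.IsBase ((insert f (B.erase e) : Finset α) : Set α) := by
    have := (hB.indep.mem_fundCircuit_iff (by rwa [hB.closure_eq]) hfB).1 he
    have := hB.exchange_isBase_of_indep' (by exact_mod_cast heB) hfB this
    rw [← Set.insert_sdiff_singleton_comm hef.symm] at this
    simpa using this
  have key := h _ hbase
  rw [Finset.sum_insert (by simp [hfB']), ← Finset.add_sum_erase _ _ heB] at key
  exact le_of_add_le_add_right key

end Sum

end Matroid

theorem isMWB_iff {α : Type*} {M : Matroid α} {w : α → ℝ} {B : Finset α} :
    IsMWB M w B ↔ M.IsLocallyMinimalBase w (B : Set α) :=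
  ⟨fun h ↦ h.1.isLocallyMinimalBase_of_sum_le h.2, fun h ↦ ⟨h.1, fun _ ↦ h.sum_le⟩⟩

/-! ### Replacing the basis that a certificate verifies -/

namespace Matroid

variable {α Γ : Type*} [LinearOrder Γ] {M : Matroid α} {w : α → Γ} {B : Set α} {e f : α}

/-- `e` is the unique heaviest element of a circuit. -/
def IsUniqueMaxOfCircuit (M : Matroid α) (w : α → Γ) (e : α) : Prop :=
  ∃ C, M.IsCircuit C ∧ e ∈ C ∧ ∀ g ∈ C, g ≠ e → w g < w e

/-- `e` is the unique lightest element of a cocircuit. -/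
def IsUniqueMinOfCocircuit (M : Matroid α) (w : α → Γ) (e : α) : Prop :=
  ∃ D, M.IsCocircuit D ∧ e ∈ D ∧ ∀ g ∈ D, g ≠ e → w e < w g

/-- Otherwise the fundamental cocircuit of `e` meets the circuit in a second element, which is
lighter than `e` although `B` could take it in exchange. -/
lemma IsUniqueMaxOfCircuit.notMem (he : M.IsUniqueMaxOfCircuit w e)
    (hB : M.IsLocallyMinimalBase w B) : e ∉ B := by
  intro heB
  obtain ⟨C, hC, heC, hlt⟩ := he
  obtain ⟨g, hgC, hgD, hge⟩ := hC.exists_ne_mem_of_isCocircuit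
    (fundCocircuit_isCocircuit heB hB.1) heC (M.mem_fundCocircuit e B)
  exact (hlt g hgC hge).not_ge (hB.le_of_mem_fundCocircuit hgD)

lemma IsUniqueMinOfCocircuit.mem (he : M.IsUniqueMinOfCocircuit w e)
    (hB : M.IsLocallyMinimalBase w B) : e ∈ B := by
  by_contra heB
  obtain ⟨D, hD, heD, hlt⟩ := he
  have heE := hD.subset_ground heD
  obtain ⟨g, hgC, hgD, hge⟩ := (hB.1.fundCircuit_isCircuit heE heB).exists_ne_mem_of_isCocircuit
    hD (M.mem_fundCircuit e B) heD
  exact (hlt g hgD hge).not_ge (hB.2 e ⟨heE, heB⟩ g hgC)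

/-- Without such a `g`, the fundamental circuit itself would have `e` as its unique heaviest
element. -/
lemma IsLocallyMinimalBase.exists_mem_fundCircuit_eq (hB : M.IsLocallyMinimalBase w B)
    (heE : e ∈ M.E) (heB : e ∉ B) (he : ¬ M.IsUniqueMaxOfCircuit w e) :
    ∃ g ∈ M.fundCircuit e B, g ≠ e ∧ w g = w e := by
  by_contra! h
  exact he ⟨_, hB.1.fundCircuit_isCircuit heE heB, M.mem_fundCircuit e B,
    fun g hg hge ↦ (hB.2 e ⟨heE, heB⟩ g hg).lt_of_ne (h g hg hge)⟩

lemma IsLocallyMinimalBase.exists_mem_fundCocircuit_eq (hB : M.IsLocallyMinimalBase w B)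
    (heB : e ∈ B) (he : ¬ M.IsUniqueMinOfCocircuit w e) :
    ∃ g ∈ M.fundCocircuit e B, g ≠ e ∧ w g = w e := by
  by_contra! h
  exact he ⟨_, fundCocircuit_isCocircuit heB hB.1, M.mem_fundCocircuit e B,
    fun g hg hge ↦ (hB.le_of_mem_fundCocircuit hg).lt_of_ne (h g hg hge).symm⟩

/-- A threshold on a fundamental circuit carries over to every other locally minimal base. -/
lemma IsLocallyMinimalBase.fundCircuit_le {B' : Set α} (hB' : M.IsLocallyMinimalBase w B')
    (hB : M.IsBase B) (hfE : f ∈ M.E) (hf : f ∉ B) {y : Γ}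
    (h : ∀ e ∈ M.fundCircuit f B, e ≠ f → w e ≤ y) (he : e ∈ M.fundCircuit f B') (hef : e ≠ f) :
    w e ≤ y := by
  have heB' := mem_of_mem_fundCircuit_of_ne he hef
  -- The circuit of `f` in `B` and the cocircuit of `e` in `B'` share `f`, hence also some `g ≠ f`,
  -- and `w e ≤ w g ≤ y`.
  obtain ⟨g, hgC, hgD, hgf⟩ := (hB.fundCircuit_isCircuit hfE hf).exists_ne_mem_of_isCocircuit
    (fundCocircuit_isCocircuit heB' hB'.1) (M.mem_fundCircuit f B)
    (hB'.1.mem_fundCocircuit_iff_mem_fundCircuit.2 he)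
  exact (hB'.le_of_mem_fundCocircuit hgD).trans (h g hgC hgf)

/-- A threshold on a fundamental cocircuit carries over to every other locally minimal base. -/
lemma IsLocallyMinimalBase.le_fundCocircuit {B' : Set α} (hB' : M.IsLocallyMinimalBase w B')
    (hB : M.IsBase B) (he : e ∈ B) {x : Γ}
    (h : ∀ f ∈ M.fundCocircuit e B, f ≠ e → x ≤ w f) (hfe : f ∈ M.fundCocircuit e B')
    (hne : f ≠ e) : x ≤ w f := by
  have hf := mem_ground_sdiff_of_mem_fundCocircuit_of_ne hfe hne
  obtain ⟨g, hgC, hgD, hge⟩ :=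
    (hB'.1.fundCircuit_isCircuit hf.1 hf.2).exists_ne_mem_of_isCocircuit
    (fundCocircuit_isCocircuit he hB) (hB'.1.mem_fundCocircuit_iff_mem_fundCircuit.1 hfe)
    (M.mem_fundCocircuit e B)
  exact (h g hgD hge).trans (hB'.2 f hf g hgC)

/-- If a fundamental circuit of one base lies below a fundamental cocircuit of another one, then
both bases agree on whether the two elements can be exchanged. -/
lemma IsBase.mem_fundCircuit_of_lt {B' : Set α} (hB : M.IsBase B) (hB' : M.IsBase B')
    (hfE : f ∈ M.E) (hf : f ∉ B) (heB' : e ∈ B') {x y : Γ} (hyx : y < x)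
    (hC : ∀ g ∈ M.fundCircuit f B, g ≠ f → w g ≤ y)
    (hD : ∀ g ∈ M.fundCocircuit e B', g ≠ e → x ≤ w g)
    (he : e ∈ M.fundCircuit f B') : e ∈ M.fundCircuit f B := by
  -- A common element `g` other than `e` and `f` would give `x ≤ w g ≤ y`, so the second common
  -- element must be `e`.
  obtain ⟨g, hgC, hgD, hgf⟩ := (hB.fundCircuit_isCircuit hfE hf).exists_ne_mem_of_isCocircuit
    (fundCocircuit_isCocircuit heB' hB') (M.mem_fundCircuit f B)
    (hB'.mem_fundCocircuit_iff_mem_fundCircuit.2 he)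
  by_contra hne
  have hge : g ≠ e := by rintro rfl; exact hne hgC
  exact (hyx.trans_le (hD g hgD hge)).not_ge (hC g hgC hgf)

end Matroid

namespace WeightedUncertaintyMatroid

/-! ### Certificates as conditions on pairs, and the queries forced by ties. -/

open Matroid

variable {α : Type*} (𝓜 : WeightedUncertaintyMatroid α) {Q B : Finset α}

theorem verifies_iff : 𝓜.Verifies Q B ↔
    𝓜.matroid.IsLocallyMinimalBase 𝓜.weight (B : Set α) ∧
      ∀ f ∉ B, ∀ e ∈ 𝓜.matroid.fundCircuit f B, e ≠ f → ∀ x ∈ 𝓜.area e, ∀ y ∈ 𝓜.area f,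
        (e ∈ Q → x = 𝓜.weight e) → (f ∈ Q → y = 𝓜.weight f) → x ≤ y := by
  classical
  have hE : ∀ f, f ∈ 𝓜.matroid.E := fun f ↦ 𝓜.ground_eq ▸ Set.mem_univ f
  simp only [Verifies, isMWB_iff]
  refine and_congr_right fun hB ↦ ⟨fun h f hf e he hef x hx y hy hxQ hyQ ↦ ?_,
    fun h w' hw' ↦ ⟨hB.1, fun f hf e he ↦ ?_⟩⟩
  -- Only the values at `e` and `f` matter for this pair, so all other elements keep their true
  -- weights.
  · have := (h (Function.update (Function.update 𝓜.weight e x) f y) ⟨fun g ↦ ?_, fun g hg ↦ ?_⟩).2 f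
      ⟨hE f, by exact_mod_cast hf⟩ e he
    · simpa [hef] using this
    · obtain rfl | hgf := eq_or_ne g f
      · simpa
      obtain rfl | hge := eq_or_ne g e
      · simpa [hgf]
      simpa [hgf, hge] using 𝓜.weight_mem g
    · obtain rfl | hgf := eq_or_ne g f
      · simpa using hyQ hg
      obtain rfl | hge := eq_or_ne g e
      · simpa [hgf] using hxQ hg
      simp [hgf, hge]
  · obtain rfl | hef := eq_or_ne e f
    · exact le_rfl
    exact h f (by exact_mod_cast hf.2) e he hef _ (hw'.1 e) _ (hw'.1 f) (hw'.2 e) (hw'.2 f)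

/-- The area of `e` contains a number below the weight of `e`. -/
def CanBeLower (e : α) : Prop := ∃ x ∈ 𝓜.area e, x < 𝓜.weight e

/-- The area of `e` contains a number above the weight of `e`. -/
def CanBeHigher (e : α) : Prop := ∃ x ∈ 𝓜.area e, 𝓜.weight e < x

open Classical in
/-- The price for having `e` in the basis instead of outside of it when its weight is tied. -/
noncomputable def tiePrice (e : α) : ℝ :=
  (if 𝓜.CanBeHigher e then 𝓜.cost e else 0) - if 𝓜.CanBeLower e then 𝓜.cost e else 0

/-- In every minimum-weight basis `e` can be exchanged with an element of the same weight. -/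
def Tied (e : α) : Prop :=
  ¬ 𝓜.matroid.IsUniqueMaxOfCircuit 𝓜.weight e ∧ ¬ 𝓜.matroid.IsUniqueMinOfCocircuit 𝓜.weight e

open Classical in
/-- The tied elements that have to be queried in order to verify `B`. -/
noncomputable def forcedTied [Fintype α] (B : Finset α) : Finset α :=
  Finset.univ.filter fun e ↦
    𝓜.Tied e ∧ if e ∈ B then 𝓜.CanBeHigher e else 𝓜.CanBeLower e

variable {𝓜} {B' : Finset α}

/-- The partner of equal weight may always take its true weight, queried or not; moving `e` past
that value would then invalidate `B`. -/
lemma Tied.mem_of_verifies {e : α} (he : 𝓜.Tied e) (h : 𝓜.Verifies Q B)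
    (hB : (e ∈ B ∧ 𝓜.CanBeHigher e) ∨ (e ∉ B ∧ 𝓜.CanBeLower e)) : e ∈ Q := by
  rw [verifies_iff] at h
  by_contra heQ
  obtain ⟨heB, x, hx, hlt⟩ | ⟨heB, x, hx, hlt⟩ := hB
  · obtain ⟨g, hg, hge, hw⟩ := h.1.exists_mem_fundCocircuit_eq (by exact_mod_cast heB) he.2
    have hgB := (mem_ground_sdiff_of_mem_fundCocircuit_of_ne hg hge).2
    have := h.2 g (by exact_mod_cast hgB) e (h.1.1.mem_fundCocircuit_iff_mem_fundCircuit.1 hg)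
      hge.symm x hx _ (𝓜.weight_mem g) (fun h ↦ absurd h heQ) (fun _ ↦ rfl)
    linarith
  · obtain ⟨g, hg, hge, hw⟩ := h.1.exists_mem_fundCircuit_eq (𝓜.ground_eq ▸ Set.mem_univ e)
      (by exact_mod_cast heB) he.1
    have := h.2 e heB g hg hge _ (𝓜.weight_mem g) x hx (fun _ ↦ rfl) (fun h ↦ absurd h heQ)
    linarith

variable [Fintype α]

lemma mem_forcedTied {e : α} : e ∈ 𝓜.forcedTied B ↔
    𝓜.Tied e ∧ ((e ∈ B ∧ 𝓜.CanBeHigher e) ∨ (e ∉ B ∧ 𝓜.CanBeLower e)) := by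
  by_cases h : e ∈ B <;> simp [forcedTied, h]

-- Start from the cost of having all tied elements outside the basis; putting one inside changes it
-- by its `tiePrice`. The subtracted sum over untied elements is the same for all MWBs.
open Classical in
lemma sum_forcedTied : ∑ e ∈ 𝓜.forcedTied B, 𝓜.cost e =
    (∑ e with 𝓜.Tied e, if 𝓜.CanBeLower e then 𝓜.cost e else 0) +
      (∑ e ∈ B, 𝓜.tiePrice e - ∑ e ∈ B with ¬ 𝓜.Tied e, 𝓜.tiePrice e) := by
  have hB : B.filter 𝓜.Tied = (Finset.univ.filter 𝓜.Tied).filter (· ∈ B) := by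
    ext; simp [and_comm]
  rw [← Finset.sum_filter_add_sum_filter_not B 𝓜.Tied, add_sub_cancel_right, hB,
    Finset.sum_filter (· ∈ B), ← Finset.sum_add_distrib, forcedTied, ← Finset.filter_filter,
    Finset.sum_filter]
  refine Finset.sum_congr rfl fun e _ ↦ ?_
  by_cases h : e ∈ B <;> simp [h, tiePrice]

theorem exists_verifies_of_lex_minimal
    (hlex : 𝓜.matroid.IsLocallyMinimalBase (fun e ↦ toLex (𝓜.weight e, 𝓜.tiePrice e)) (B' : Set α))
    (h : 𝓜.Verifies Q B) :
    ∃ Q', 𝓜.Verifies Q' B' ∧ ∑ e ∈ Q', 𝓜.cost e ≤ ∑ e ∈ Q, 𝓜.cost e := by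
  classical
  have hB' : 𝓜.matroid.IsLocallyMinimalBase 𝓜.weight (B' : Set α) :=
    hlex.comp_monotone fun e f hef ↦ Prod.Lex.monotone_fst _ _ hef
  have hQ := 𝓜.verifies_iff.1 h
  have hE : ∀ f, f ∈ 𝓜.matroid.E := fun f ↦ 𝓜.ground_eq ▸ Set.mem_univ f
  have hout : ∀ f, ¬ 𝓜.Tied f → f ∉ B' → f ∉ B := fun f hf hfB' ↦ by
    have : 𝓜.matroid.IsUniqueMaxOfCircuit 𝓜.weight f := by
      by_contra hmax
      exact hf ⟨hmax, fun hmin ↦ hfB' (by exact_mod_cast hmin.mem hB')⟩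
    exact_mod_cast this.notMem hQ.1
  have hin : ∀ f, ¬ 𝓜.Tied f → f ∈ B' → f ∈ B := fun f hf hfB' ↦ by
    have : 𝓜.matroid.IsUniqueMinOfCocircuit 𝓜.weight f := by
      by_contra hmin
      exact hf ⟨fun hmax ↦ hmax.notMem hB' (by exact_mod_cast hfB'), hmin⟩
    exact_mod_cast this.mem hQ.1
  -- Untied elements lie on the same side of both bases, so their queries are kept; those of tied
  -- elements are replaced by the ones `B'` forces.
  refine ⟨Q.filter (¬ 𝓜.Tied ·) ∪ 𝓜.forcedTied B', 𝓜.verifies_iff.2 ⟨hB', ?_⟩, ?_⟩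
  · intro f hf e he hef x hx y hy hxQ hyQ
    have hle : 𝓜.weight e ≤ 𝓜.weight f := hB'.2 f ⟨hE f, by exact_mod_cast hf⟩ e he
    have heB' : e ∈ B' := by exact_mod_cast mem_of_mem_fundCircuit_of_ne he hef
    have hfe : f ∈ 𝓜.matroid.fundCocircuit e B' :=
      hB'.1.mem_fundCocircuit_iff_mem_fundCircuit.2 he
    have hxe : (𝓜.Tied e ∨ e ∈ Q) → x ≤ 𝓜.weight e := by
      intro h1
      by_contra! hlt
      refine hlt.ne' (hxQ ?_)
      by_cases ht : 𝓜.Tied e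
      · exact Finset.mem_union_right _ (mem_forcedTied.2 ⟨ht, .inl ⟨heB', x, hx, hlt⟩⟩)
      · exact Finset.mem_union_left _ (Finset.mem_filter.2 ⟨h1.resolve_left ht, ht⟩)
    have hyf : (𝓜.Tied f ∨ f ∈ Q) → 𝓜.weight f ≤ y := by
      intro h1
      by_contra! hlt
      refine hlt.ne (hyQ ?_)
      by_cases ht : 𝓜.Tied f
      · exact Finset.mem_union_right _ (mem_forcedTied.2 ⟨ht, .inr ⟨hf, y, hy, hlt⟩⟩)
      · exact Finset.mem_union_left _ (Finset.mem_filter.2 ⟨h1.resolve_left ht, ht⟩)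
    have hC : ¬ (𝓜.Tied f ∨ f ∈ Q) → ∀ g ∈ 𝓜.matroid.fundCircuit f B, g ≠ f → 𝓜.weight g ≤ y := by
      intro h1 g hg hgf
      push Not at h1
      exact hQ.2 f (hout f h1.1 hf) g hg hgf _ (𝓜.weight_mem g) y hy (fun _ ↦ rfl)
        (fun h ↦ absurd h h1.2)
    have hD : ¬ (𝓜.Tied e ∨ e ∈ Q) → ∀ g ∈ 𝓜.matroid.fundCocircuit e B, g ≠ e →
        x ≤ 𝓜.weight g := by
      intro h1 g hg hge
      push Not at h1
      have hgB := (mem_ground_sdiff_of_mem_fundCocircuit_of_ne hg hge).2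
      exact hQ.2 g (by exact_mod_cast hgB) e (hQ.1.1.mem_fundCocircuit_iff_mem_fundCircuit.1 hg)
        hge.symm x hx _ (𝓜.weight_mem g) (fun h ↦ absurd h h1.2) (fun _ ↦ rfl)
    -- A tied or queried element cannot cross its true weight in the harmful direction. Any other
    -- element is untied and unqueried, so `Q` bounds its values by the true weights on its circuit
    -- or cocircuit in `B`, and this bound transfers to `B'`.
    by_cases h1 : 𝓜.Tied e ∨ e ∈ Q <;> by_cases h2 : 𝓜.Tied f ∨ f ∈ Q
    · exact (hxe h1).trans (hle.trans (hyf h2))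
    · have hfB : f ∉ (B : Set α) := by exact_mod_cast hout f (fun h ↦ h2 (.inl h)) hf
      exact (hxe h1).trans (hB'.fundCircuit_le hQ.1.1 (hE f) hfB (hC h2) he hef)
    · have heB : e ∈ (B : Set α) := by exact_mod_cast hin e (fun h ↦ h1 (.inl h)) heB'
      exact (hB'.le_fundCocircuit hQ.1.1 heB (hD h1) hfe hef.symm).trans (hyf h2)
    · have hfB : f ∉ (B : Set α) := by exact_mod_cast hout f (fun h ↦ h2 (.inl h)) hf
      have heB : e ∈ (B : Set α) := by exact_mod_cast hin e (fun h ↦ h1 (.inl h)) heB'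
      -- If `y < x`, the transferred bounds force `e` onto the circuit of `f` in `B`, where the
      -- verification by `Q` already gives `x ≤ y`.
      by_contra! hyx
      have := hQ.1.1.mem_fundCircuit_of_lt hB'.1 (hE f) hfB (by exact_mod_cast heB') hyx (hC h2)
        (fun g hg hge ↦ hB'.le_fundCocircuit hQ.1.1 heB (hD h1) hg hge) he
      refine hyx.not_ge (hQ.2 f (by exact_mod_cast hfB) e this hef x hx y hy ?_ ?_)
      · exact fun h ↦ absurd (.inr h) h1
      · exact fun h ↦ absurd (.inr h) h2
  · have hsub : 𝓜.forcedTied B ⊆ Q.filter 𝓜.Tied := fun e he ↦ by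
      rw [mem_forcedTied] at he
      exact Finset.mem_filter.2 ⟨he.1.mem_of_verifies h he.2, he.1⟩
    have h1 := Finset.sum_le_sum_of_subset_of_nonneg hsub (f := 𝓜.cost)
      fun e _ _ ↦ 𝓜.cost_nonneg e
    have h2 : ∑ e ∈ B', 𝓜.tiePrice e ≤ ∑ e ∈ B, 𝓜.tiePrice e := by
      have hl := hlex.sum_le hQ.1.1
      have hfst : ∀ S : Finset α, ∑ e ∈ S, toLex (𝓜.weight e, 𝓜.tiePrice e) =
          toLex (∑ e ∈ S, 𝓜.weight e, ∑ e ∈ S, 𝓜.tiePrice e) := fun S ↦ by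
        induction S using Finset.induction_on with
        | empty => simp only [Finset.sum_empty]; rfl
        | insert e S he ih => simp only [Finset.sum_insert he, ih]; rfl
      rw [hfst, hfst, Prod.Lex.toLex_le_toLex] at hl
      -- Both bases have minimum weight, so the lexicographic comparison is decided by the second
      -- coordinate.
      obtain hl | hl := hl
      · exact absurd (hQ.1.sum_le hB'.1) (not_le.2 hl)
      · exact hl.2
    have h3 : B.filter (¬ 𝓜.Tied ·) = B'.filter (¬ 𝓜.Tied ·) := by
      ext e
      simp only [Finset.mem_filter]
      exact and_congr_left fun ht ↦ ⟨fun h ↦ by_contra fun h' ↦ hout e ht h' h, hin e ht⟩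
    have h4 := sum_forcedTied (𝓜 := 𝓜) (B := B)
    have h5 := sum_forcedTied (𝓜 := 𝓜) (B := B')
    rw [h3] at h4
    have h6 := Finset.sum_filter_add_sum_filter_not Q 𝓜.Tied 𝓜.cost
    have h7 := Finset.sum_union_inter (s₁ := Q.filter (¬ 𝓜.Tied ·)) (s₂ := 𝓜.forcedTied B')
      (f := 𝓜.cost)
    have h8 := Finset.sum_nonneg (s := Q.filter (¬ 𝓜.Tied ·) ∩ 𝓜.forcedTied B') (f := 𝓜.cost)
      fun e _ ↦ 𝓜.cost_nonneg e
    linarith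

/-- Querying everything verifies `B`, so a cheapest set verifying `B` exists; by the replacement
theorem no certificate for another basis is cheaper. -/
theorem exists_isMinCostCertificate_verifies
    (hlex : 𝓜.matroid.IsLocallyMinimalBase (fun e ↦ toLex (𝓜.weight e, 𝓜.tiePrice e))
      (B : Set α)) :
    IsMWB 𝓜.matroid 𝓜.weight B ∧ ∃ Q, 𝓜.IsMinCostCertificate Q ∧ 𝓜.Verifies Q B := by
  classical
  have hB : 𝓜.matroid.IsLocallyMinimalBase 𝓜.weight (B : Set α) :=
    hlex.comp_monotone fun e f hef ↦ Prod.Lex.monotone_fst _ _ hef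
  have huniv : 𝓜.Verifies Finset.univ B := by
    refine ⟨isMWB_iff.2 hB, fun w' hw' ↦ ?_⟩
    rw [show w' = 𝓜.weight from funext fun e ↦ hw'.2 e (Finset.mem_univ e)]
    exact isMWB_iff.2 hB
  obtain ⟨Q, hQ, hmin⟩ := Finset.exists_min_image
    (Finset.univ.filter fun Q ↦ 𝓜.Verifies Q B) (fun Q ↦ ∑ e ∈ Q, 𝓜.cost e)
    ⟨_, Finset.mem_filter.2 ⟨Finset.mem_univ _, huniv⟩⟩
  have hQ := (Finset.mem_filter.1 hQ).2
  refine ⟨isMWB_iff.2 hB, Q, ⟨⟨B, hQ⟩, fun Q' B' h ↦ ?_⟩, hQ⟩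
  obtain ⟨Q'', hQ'', hle⟩ := exists_verifies_of_lex_minimal hlex h
  exact (hmin Q'' (Finset.mem_filter.2 ⟨Finset.mem_univ _, hQ''⟩)).trans hle

end WeightedUncertaintyMatroid

/-! ### The greedy algorithm -/

namespace Matroid

variable {α Γ : Type*} [LinearOrder Γ] {M : Matroid α} {κ : α → Γ} {P S : Set α} {b : α}

/-- The state of the greedy algorithm after the elements of `P` have been processed and those of
`S` have been selected. -/
structure IsGreedyState (M : Matroid α) (κ : α → Γ) (P S : Set α) : Prop where
  subset : S ⊆ P
  indep : M.Indep S
  -- The restriction to keys at most `κ f` is what later bounds the fundamental circuit of `f`.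
  mem_closure : ∀ f ∈ P, f ∉ S → f ∈ M.closure {e ∈ S | κ e ≤ κ f}
  le : ∀ p ∈ P, ∀ q ∉ P, κ p ≤ κ q

lemma isGreedyState_empty (M : Matroid α) (κ : α → Γ) : M.IsGreedyState κ ∅ ∅ :=
  ⟨Set.Subset.rfl, M.empty_indep, by simp, by simp⟩

lemma IsGreedyState.insert_of_indep (h : M.IsGreedyState κ P S) (hbP : b ∉ P)
    (hmin : ∀ q ∉ P, κ b ≤ κ q) (hb : M.Indep (insert b S)) :
    M.IsGreedyState κ (insert b P) (insert b S) where
  subset := Set.insert_subset_insert h.subset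
  indep := hb
  mem_closure f hf hfS := by
    have hfP : f ∈ P := hf.resolve_left fun h ↦ hfS (.inl h)
    refine M.closure_subset_closure ?_ (h.mem_closure f hfP fun h ↦ hfS (.inr h))
    exact fun e he ↦ ⟨.inr he.1, he.2⟩
  le p hp q hq := by
    have hq' : q ∉ P := fun h ↦ hq (.inr h)
    obtain rfl | hp := hp
    · exact hmin q hq'
    · exact h.le p hp q hq'

lemma IsGreedyState.insert_of_not_indep (h : M.IsGreedyState κ P S) (hbE : b ∈ M.E) (hbP : b ∉ P)
    (hmin : ∀ q ∉ P, κ b ≤ κ q) (hb : ¬ M.Indep (insert b S)) :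
    M.IsGreedyState κ (insert b P) S where
  subset := h.subset.trans (Set.subset_insert _ _)
  indep := h.indep
  mem_closure f hf hfS := by
    obtain rfl | hfP := hf
    · have : {e ∈ S | κ e ≤ κ f} = S :=
        Set.sep_eq_self_iff_mem_true.2 fun e he ↦ h.le e (h.subset he) f hbP
      rw [this]
      by_contra hcl
      exact hb ((h.indep.notMem_closure_iff_of_notMem hfS hbE).1 hcl)
    · exact h.mem_closure f hfP hfS
  le p hp q hq := by
    have hq' : q ∉ P := fun h ↦ hq (.inr h)
    obtain rfl | hp := hp
    · exact hmin q hq'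
    · exact h.le p hp q hq'

lemma IsGreedyState.isLocallyMinimalBase (h : M.IsGreedyState κ Set.univ S) :
    M.IsLocallyMinimalBase κ S := by
  have hcl : ∀ f, f ∉ S → f ∈ M.closure {e ∈ S | κ e ≤ κ f} := fun f ↦ h.mem_closure f trivial
  have hS : M.E ⊆ M.closure S := fun f hfE ↦ by
    by_cases hf : f ∈ S
    · exact M.mem_closure_of_mem' hf
    · exact M.closure_subset_closure (Set.sep_subset _ _) (hcl f hf)
  refine ⟨h.indep.isBase_of_ground_subset_closure hS, fun f hf e he ↦ ?_⟩
  -- Apart from `f`, the fundamental circuit lies in every subset of `S` that spans `f`, in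
  -- particular in the one with keys at most `κ f`.
  rw [fundCircuit_eq_sInter (hS hf.1)] at he
  obtain rfl | he := he
  · exact le_rfl
  · exact (he _ ⟨Set.sep_subset _ _, hcl f hf.2⟩).2

end Matroid

/-! ### Reasoning about programs -/

/-- From the memory `s`, the program `P` halts within time `T` in a memory that satisfies `post`. -/
def Halts (env : Env) (P : Program) (s : Memory) (T : ℕ) (post : Memory → Prop) : Prop :=
  ∃ s' t, Exec env P s s' t ∧ t ≤ T ∧ post s'

namespace Halts

variable {env : Env} {P Q : Program} {s : Memory} {T T' : ℕ} {post post' : Memory → Prop}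

theorem mono (h : Halts env P s T post) (hT : T ≤ T') (hpost : ∀ s', post s' → post' s') :
    Halts env P s T' post' := by
  obtain ⟨s', t, he, ht, hp⟩ := h
  exact ⟨s', t, he, ht.trans hT, hpost s' hp⟩

theorem skip (h : post s) : Halts env .skip s 1 post := ⟨_, _, .skip s, le_rfl, h⟩

theorem assign {r : ℕ} {x : Expr} (h : post (s.setReg r (x.eval s))) :
    Halts env (.assign r x) s (1 + x.time) post := ⟨_, _, .assign r x s, le_rfl, h⟩

theorem store {a : ℕ} {i x : Expr} (h : post (s.setArr a (i.eval s) (x.eval s))) :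
    Halts env (.store a i x) s (1 + i.time + x.time) post := ⟨_, _, .store a i x s, le_rfl, h⟩

theorem seq (h : Halts env P s T fun s' ↦ Halts env Q s' T' post) :
    Halts env (.seq P Q) s (T + T') post := by
  obtain ⟨s', t, he, ht, s'', t', he', ht', hp⟩ := h
  exact ⟨s'', t + t', .seq he he', by omega, hp⟩

theorem ite {p : Test} (h : p.Holds env s → Halts env P s T post)
    (h' : ¬ p.Holds env s → Halts env Q s T' post) :
    Halts env (.ite p P Q) s (1 + p.time env + (T + T')) post := by
  by_cases hp : p.Holds env s
  · obtain ⟨s', t, he, ht, hs⟩ := h hp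
    exact ⟨s', _, .ite_true hp he, by omega, hs⟩
  · obtain ⟨s', t, he, ht, hs⟩ := h' hp
    exact ⟨s', _, .ite_false hp he, by omega, hs⟩

end Halts

/-- Run `P` with register `r` set to `0, 1, …`, up to the value of register `b` minus one. -/
def Program.for (r b : ℕ) (P : Program) : Program :=
  .seq (.assign r (.lit 0))
    (.while (.not (.le (.reg b) (.reg r))) (.seq P (.assign r (.add (.reg r) (.lit 1)))))

/-- Each round costs 5 for the test and 4 for the increment besides the body; the remaining 7 pay
for the initial assignment and the final failing test. The invariant speaks of the memory after the
counter has been set. -/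
theorem Halts.for {env : Env} {r b N T : ℕ} {P : Program} {s : Memory} (hrb : r ≠ b)
    (Inv : ℕ → Memory → Prop) (hN : s.reg b = N) (h0 : Inv 0 (s.setReg r 0))
    (step : ∀ i < N, ∀ s, s.reg r = i → s.reg b = N → Inv i s →
      Halts env P s T fun s' ↦ s'.reg r = i ∧ s'.reg b = N ∧ Inv (i + 1) (s'.setReg r (i + 1))) :
    Halts env (.for r b P) s (N * (T + 9) + 7) fun s' ↦ s'.reg b = N ∧ Inv N s' := by
  have loop : ∀ k i s, i + k = N → s.reg r = i → s.reg b = N → Inv i s →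
      Halts env (.while (.not (.le (.reg b) (.reg r))) (.seq P (.assign r (.add (.reg r) (.lit 1)))))
        s (k * (T + 9) + 5) fun s' ↦ s'.reg b = N ∧ Inv N s' := by
    intro k
    induction k with
    | zero =>
      intro i s hi hr hb hs
      obtain rfl : i = N := by omega
      exact ⟨s, _, .while_false (by simp [Test.Holds, Expr.eval, hr, hb]), by
        simp [Test.time, Expr.time], hb, hs⟩
    | succ k ih =>
      intro i s hi hr hb hs
      obtain ⟨s', t, he, ht, hr', hb', hs'⟩ := step i (by omega) s hr hb hs
      obtain ⟨s'', t', he', ht', hb'', hs''⟩ := ih (i + 1) (s'.setReg r (i + 1)) (by omega)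
        (by simp [Memory.setReg]) (by simpa [Memory.setReg, hrb.symm] using hb') hs'
      have hinc : Exec env (.assign r (.add (.reg r) (.lit 1))) s' (s'.setReg r (i + 1)) 4 := by
        have := Exec.assign (env := env) r (.add (.reg r) (.lit 1)) s'
        simpa [Expr.eval, Expr.time, hr'] using this
      refine ⟨s'', _, .while_true ?_ (.seq he hinc) he', ?_, hb'', hs''⟩
      · simp [Test.Holds, Expr.eval, hr, hb]; omega
      · simp only [Test.time, Expr.time, Nat.succ_mul]; omega
  refine (Halts.seq (T := 2) (T' := N * (T + 9) + 5) ?_).mono (by omega) fun _ h ↦ h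
  exact Halts.assign (loop N 0 _ (by omega) (by simp [Memory.setReg, Expr.eval])
    (by simpa [Memory.setReg, hrb.symm] using hN) h0)

namespace Test

/-- Disjunction of tests. -/
def or (p q : Test) : Test := .not (.and (.not p) (.not q))

/-- Strict comparison of real inputs. -/
def realLt (a : ℕ) (i : Expr) (b : ℕ) (j : Expr) : Test := .not (.realLe b j a i)

variable {env : Env} {s : Memory} {p q : Test}

@[simp] lemma holds_or : (or p q).Holds env s ↔ p.Holds env s ∨ q.Holds env s := by
  simp only [or, Holds]; tauto

@[simp] lemma holds_realLt {a b : ℕ} {i j : Expr} : (realLt a i b j).Holds env s ↔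
    env.real a (i.eval s) < env.real b (j.eval s) := by
  simp [realLt, Holds]

end Test

/-! ### The program -/

namespace WeightedUncertaintyMatroid

variable {n : ℕ} (𝓜 : WeightedUncertaintyMatroid (Fin n)) {pieces : List (Fin n × BddInterval)}

/-- Open and closed intervals behave alike because they are nonempty, so the program need not read
the closedness flags. -/
lemma _root_.BddInterval.exists_mem_lt_iff (I : BddInterval) {c : ℝ} :
    (∃ x ∈ I.toSet, x < c) ↔ I.lower < c := by
  have hv := I.valid
  cases hI : I.closed <;> simp only [hI, Bool.false_eq_true, if_true, if_false] at hv <;>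
    simp only [BddInterval.toSet, hI, Bool.false_eq_true, if_true, if_false]
  · refine ⟨fun ⟨x, hx, h⟩ ↦ hx.1.trans h, fun h ↦ ?_⟩
    obtain ⟨x, hx, hx'⟩ := exists_between (lt_min hv h)
    exact ⟨x, ⟨hx, hx'.trans_le (min_le_left _ _)⟩, hx'.trans_le (min_le_right _ _)⟩
  · exact ⟨fun ⟨x, hx, h⟩ ↦ hx.1.trans_lt h, fun h ↦ ⟨_, ⟨le_rfl, hv⟩, h⟩⟩

lemma _root_.BddInterval.exists_mem_gt_iff (I : BddInterval) {c : ℝ} :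
    (∃ x ∈ I.toSet, c < x) ↔ c < I.upper := by
  have hv := I.valid
  cases hI : I.closed <;> simp only [hI, Bool.false_eq_true, if_true, if_false] at hv <;>
    simp only [BddInterval.toSet, hI, Bool.false_eq_true, if_true, if_false]
  · refine ⟨fun ⟨x, hx, h⟩ ↦ h.trans hx.2, fun h ↦ ?_⟩
    obtain ⟨x, hx, hx'⟩ := exists_between (max_lt hv h)
    exact ⟨x, ⟨(le_max_left _ _).trans_lt hx, hx'⟩, (le_max_right _ _).trans_lt hx⟩
  · exact ⟨fun ⟨x, hx, h⟩ ↦ h.trans_le hx.2, fun h ↦ ⟨_, ⟨hv, le_rfl⟩, h⟩⟩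

variable {𝓜} in
lemma DescribedBy.canBeLower_iff (h : 𝓜.DescribedBy pieces) (e : Fin n) :
    𝓜.CanBeLower e ↔ ∃ I, (e, I) ∈ pieces ∧ I.lower < 𝓜.weight e := by
  simp only [CanBeLower, h e, Set.mem_ofPred_eq, ← BddInterval.exists_mem_lt_iff]
  exact ⟨fun ⟨x, ⟨I, hI, hx⟩, hlt⟩ ↦ ⟨I, hI, x, hx, hlt⟩,
    fun ⟨I, hI, x, hx, hlt⟩ ↦ ⟨x, ⟨I, hI, hx⟩, hlt⟩⟩

variable {𝓜} in
lemma DescribedBy.canBeHigher_iff (h : 𝓜.DescribedBy pieces) (e : Fin n) :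
    𝓜.CanBeHigher e ↔ ∃ I, (e, I) ∈ pieces ∧ 𝓜.weight e < I.upper := by
  simp only [CanBeHigher, h e, Set.mem_ofPred_eq, ← BddInterval.exists_mem_gt_iff]
  exact ⟨fun ⟨x, ⟨I, hI, hx⟩, hlt⟩ ↦ ⟨I, hI, x, hx, hlt⟩,
    fun ⟨I, hI, x, hx, hlt⟩ ↦ ⟨x, ⟨I, hI, hx⟩, hlt⟩⟩

open Classical in
/-- The arrays `3` and `4` tell which elements can be lower or higher than their weight. -/
def IsClassified (a : ℕ → ℕ → ℕ) : Prop :=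
  ∀ e : Fin n, a 3 e = (if 𝓜.CanBeLower e then 1 else 0) ∧
    a 4 e = if 𝓜.CanBeHigher e then 1 else 0

/-- Find out which elements can be lower or higher than their weight. -/
def classify : Program :=
  .for 2 1 (.seq
    (.ite (.realLt 2 (.reg 2) 0 (.get 0 (.reg 2))) (.store 3 (.get 0 (.reg 2)) (.lit 1)) .skip)
    (.ite (.realLt 0 (.get 0 (.reg 2)) 3 (.reg 2)) (.store 4 (.get 0 (.reg 2)) (.lit 1)) .skip))

lemma env_real_zero (τ : ℕ) (e : Fin n) : (𝓜.env pieces τ).real 0 e = 𝓜.weight e := by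
  simp [env]

lemma env_real_one (τ : ℕ) (e : Fin n) : (𝓜.env pieces τ).real 1 e = 𝓜.cost e := by
  simp [env]

variable {𝓜} in
theorem halts_classify (h : 𝓜.DescribedBy pieces) (τ : ℕ) :
    Halts (𝓜.env pieces τ) classify (initialMemory pieces) (pieces.length * 39 + 7)
      fun s ↦ s.reg 0 = n ∧ 𝓜.IsClassified s.arr ∧ s.arr 2 = 0 ∧ s.arr 5 = 0 := by
  classical
  refine (Halts.for (r := 2) (b := 1) (N := pieces.length) (T := 30) (by decide) (fun i s ↦
    s.reg 0 = n ∧ s.arr 0 = (initialMemory pieces).arr 0 ∧ s.arr 2 = 0 ∧ s.arr 5 = 0 ∧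
      ∀ e : Fin n,
        s.arr 3 e = (if ∃ I, (e, I) ∈ pieces.take i ∧ I.lower < 𝓜.weight e then 1 else 0) ∧
        s.arr 4 e = if ∃ I, (e, I) ∈ pieces.take i ∧ 𝓜.weight e < I.upper then 1 else 0)
    rfl ⟨rfl, rfl, rfl, rfl, fun e ↦ by simp [initialMemory, Memory.setReg]⟩ ?_).mono (by omega) ?_
  · rintro i hi s hr hb ⟨h0, ha0, ha2, ha5, hfl⟩
    set e₀ := pieces[i].1 with he₀
    set I₀ := pieces[i].2 with hI₀
    have hget : s.arr 0 i = e₀ := by simp [ha0, initialMemory, hi, he₀]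
    have hlow : (𝓜.env pieces τ).real 2 i = I₀.lower := by simp [env, hi, hI₀]
    have hup : (𝓜.env pieces τ).real 3 i = I₀.upper := by simp [env, hi, hI₀]
    have htake : ∀ (e : Fin n) (p : BddInterval → Prop),
        (∃ I, (e, I) ∈ pieces.take (i + 1) ∧ p I) ↔
          (∃ I, (e, I) ∈ pieces.take i ∧ p I) ∨ (e = e₀ ∧ p I₀) := by
      intro e p
      have hp : pieces[i] = (e₀, I₀) := rfl
      rw [List.take_succ_eq_append_getElem hi, hp]
      simp only [List.mem_append, List.mem_singleton, Prod.mk.injEq, or_and_right, exists_or]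
      refine or_congr_right ⟨?_, ?_⟩
      · rintro ⟨I, ⟨he, rfl⟩, hI⟩; exact ⟨he, hI⟩
      · rintro ⟨he, hI⟩; exact ⟨_, ⟨he, rfl⟩, hI⟩
    simp only [htake]
    refine (Halts.seq (T := 14) (T' := 14) ?_).mono (by norm_num) fun _ h ↦ h
    -- The second conditional is treated for any intermediate memory, since the first one has two
    -- outcomes.
    have second : ∀ s' : Memory, s'.reg = s.reg → s'.arr 0 = s.arr 0 → s'.arr 2 = 0 →
        s'.arr 5 = 0 → s'.arr 4 = s.arr 4 → (∀ e : Fin n, s'.arr 3 e =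
          if (∃ I, (e, I) ∈ pieces.take i ∧ I.lower < 𝓜.weight e) ∨
            (e = e₀ ∧ I₀.lower < 𝓜.weight e) then 1 else 0) →
        Halts (𝓜.env pieces τ) (.ite (.realLt 0 (.get 0 (.reg 2)) 3 (.reg 2))
          (.store 4 (.get 0 (.reg 2)) (.lit 1)) .skip) s' 14 fun s' ↦
          s'.reg 2 = i ∧ s'.reg 1 = pieces.length ∧ (s'.setReg 2 (i + 1)).reg 0 = n ∧
          (s'.setReg 2 (i + 1)).arr 0 = (initialMemory pieces).arr 0 ∧
          (s'.setReg 2 (i + 1)).arr 2 = 0 ∧ (s'.setReg 2 (i + 1)).arr 5 = 0 ∧ ∀ e : Fin n,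
            ((s'.setReg 2 (i + 1)).arr 3 e =
              if (∃ I, (e, I) ∈ pieces.take i ∧ I.lower < 𝓜.weight e) ∨
                (e = e₀ ∧ I₀.lower < 𝓜.weight e) then 1 else 0) ∧
            (s'.setReg 2 (i + 1)).arr 4 e =
              if (∃ I, (e, I) ∈ pieces.take i ∧ 𝓜.weight e < I.upper) ∨
                (e = e₀ ∧ 𝓜.weight e < I₀.upper) then 1 else 0 := by
      intro s' hreg h'0 h'2 h'5 h'4 h'3
      have hc : (Test.realLt 0 (.get 0 (.reg 2)) 3 (.reg 2)).Holds (𝓜.env pieces τ) s' ↔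
          𝓜.weight e₀ < I₀.upper := by
        simp [Expr.eval, hreg, hr, h'0, hget, hup, env_real_zero]
      refine (Halts.ite (T := 4) (T' := 1) (fun hlt ↦ ?_) fun hlt ↦ ?_).mono
        (by simp [Test.realLt, Test.time, Expr.time]) fun _ h ↦ h
      · refine Halts.store ?_
        refine ⟨by simp [Memory.setArr, hreg, hr], by simp [Memory.setArr, hreg, hb],
          by simp [Memory.setArr, Memory.setReg, hreg, h0],
          by simp [Memory.setArr, Memory.setReg, h'0, ha0],
          by simp [Memory.setArr, Memory.setReg, h'2],
          by simp [Memory.setArr, Memory.setReg, h'5], fun e ↦ ⟨?_, ?_⟩⟩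
        · simpa [Memory.setArr, Memory.setReg] using h'3 e
        · rw [hc] at hlt
          by_cases he : e = e₀
          · subst he
            simp [Memory.setArr, Memory.setReg, Expr.eval, hreg, hr, h'0, hget, hlt]
          · have : (e : ℕ) ≠ e₀ := fun h ↦ he (Fin.ext h)
            simp [Memory.setArr, Memory.setReg, Expr.eval, hreg, hr, h'0, hget, he, this, h'4,
              (hfl e).2]
      · rw [hc] at hlt
        refine Halts.skip ⟨by simp [hreg, hr], by simp [hreg, hb],
          by simp [Memory.setReg, hreg, h0], by simp [Memory.setReg, h'0, ha0],
          by simp [Memory.setReg, h'2], by simp [Memory.setReg, h'5], fun e ↦ ⟨h'3 e, ?_⟩⟩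
        have : ¬ (e = e₀ ∧ 𝓜.weight e < I₀.upper) := by rintro ⟨rfl, h⟩; exact hlt h
        simp [Memory.setReg, h'4, (hfl e).2, this]
    have hc : (Test.realLt 2 (.reg 2) 0 (.get 0 (.reg 2))).Holds (𝓜.env pieces τ) s ↔
        I₀.lower < 𝓜.weight e₀ := by
      simp [Expr.eval, hr, hget, hlow, env_real_zero]
    refine (Halts.ite (T := 4) (T' := 1) (fun hlt ↦ ?_) fun hlt ↦ ?_).mono
      (by simp [Test.realLt, Test.time, Expr.time]) fun _ h ↦ h
    · refine Halts.store ?_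
      refine (second _ rfl (by simp [Memory.setArr]) (by simp [Memory.setArr, ha2])
        (by simp [Memory.setArr, ha5]) (by simp [Memory.setArr]) fun e ↦ ?_)
      rw [hc] at hlt
      by_cases he : e = e₀
      · subst he
        simp [Memory.setArr, Expr.eval, hr, hget, hlt]
      · have : (e : ℕ) ≠ e₀ := fun h ↦ he (Fin.ext h)
        simp [Memory.setArr, Expr.eval, hr, hget, he, this, (hfl e).1]
    · rw [hc] at hlt
      refine Halts.skip (second _ rfl rfl ha2 ha5 rfl fun e ↦ ?_)
      have : ¬ (e = e₀ ∧ I₀.lower < 𝓜.weight e) := by rintro ⟨rfl, h⟩; exact hlt h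
      simp [(hfl e).1, this]
  · rintro s ⟨-, h0, -, h2, h5, hfl⟩
    refine ⟨h0, fun e ↦ ?_, h2, h5⟩
    simpa [h.canBeLower_iff, h.canBeHigher_iff] using hfl e

/-! ### An order on the elements that needs only comparisons of inputs. -/

open Classical in
/-- `0` for elements that should rather be in the basis, `2` for elements that should rather be
outside of it, and `1` for all others. -/
noncomputable def tieClass (e : Fin n) : ℕ :=
  1 + (if 𝓜.CanBeHigher e then 1 else 0) - if 𝓜.CanBeLower e then 1 else 0

/-- The key by which the greedy algorithm orders the elements. -/
noncomputable def key (e : Fin n) : ℝ ×ₗ ℕ ×ₗ ℝ :=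
  toLex (𝓜.weight e, toLex (𝓜.tieClass e, if 𝓜.tieClass e = 0 then -𝓜.cost e else 𝓜.cost e))

/-- Classes `0`, `1`, `2` have prices `-cost`, `0`, `cost`, so nonnegativity of costs makes the
class decide first. In class `1` the cost only breaks ties between equal prices. -/
lemma lex_le_of_key_le {e f : Fin n} (h : 𝓜.key e ≤ 𝓜.key f) :
    toLex (𝓜.weight e, 𝓜.tiePrice e) ≤ toLex (𝓜.weight f, 𝓜.tiePrice f) := by
  have he := 𝓜.cost_nonneg e
  have hf := 𝓜.cost_nonneg f
  simp only [key, Prod.Lex.toLex_le_toLex] at h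
  rw [Prod.Lex.toLex_le_toLex]
  refine h.imp_right fun ⟨hw, h⟩ ↦ ⟨hw, ?_⟩
  by_cases h1 : 𝓜.CanBeHigher e <;> by_cases h2 : 𝓜.CanBeLower e <;>
    by_cases h3 : 𝓜.CanBeHigher f <;> by_cases h4 : 𝓜.CanBeLower f <;>
    simp [tieClass, tiePrice, h1, h2, h3, h4] at h ⊢ <;> linarith

/-- The class of the element in register `r`. -/
def classExpr (r : ℕ) : Expr := .sub (.add (.lit 1) (.get 4 (.reg r))) (.get 3 (.reg r))

/-- Test whether the key of the element in register `3` is less than that in register `4`. -/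
def keyLt : Test :=
  .or (.realLt 0 (.reg 3) 0 (.reg 4)) (.and (.realLe 0 (.reg 3) 0 (.reg 4))
    (.or (.not (.le (classExpr 4) (classExpr 3))) (.and (.le (classExpr 3) (classExpr 4))
      (.or (.and (.le (classExpr 3) (.lit 0)) (.realLt 1 (.reg 4) 1 (.reg 3)))
        (.and (.le (.lit 1) (classExpr 3)) (.realLt 1 (.reg 3) 1 (.reg 4)))))))

variable {𝓜} in
lemma IsClassified.eval_classExpr {s : Memory} (h : 𝓜.IsClassified s.arr) {r : ℕ} {e : Fin n}
    (hr : s.reg r = e) : (classExpr r).eval s = 𝓜.tieClass e := by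
  simp [classExpr, Expr.eval, hr, h e, tieClass]

variable {𝓜} in
lemma IsClassified.holds_keyLt {τ : ℕ} {s : Memory} (h : 𝓜.IsClassified s.arr) {e f : Fin n}
    (he : s.reg 3 = e) (hf : s.reg 4 = f) :
    keyLt.Holds (𝓜.env pieces τ) s ↔ 𝓜.key e < 𝓜.key f := by
  simp only [keyLt, Test.holds_or, Test.holds_realLt, Test.Holds, h.eval_classExpr he,
    h.eval_classExpr hf, Expr.eval, he, hf, env_real_zero, env_real_one, key,
    Prod.Lex.toLex_lt_toLex, not_le]
  constructor
  · rintro (h | ⟨h1, h2 | ⟨h2, ⟨h3, h4⟩ | ⟨h3, h4⟩⟩⟩)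
    · exact .inl h
    · exact h1.lt_or_eq.imp_right fun h1 ↦ ⟨h1, .inl h2⟩
    · refine h1.lt_or_eq.imp_right fun h1 ↦ ⟨h1, h2.lt_or_eq.imp_right fun h2 ↦ ⟨h2, ?_⟩⟩
      rw [if_pos (by omega), if_pos (by omega)]
      exact neg_lt_neg h4
    · refine h1.lt_or_eq.imp_right fun h1 ↦ ⟨h1, h2.lt_or_eq.imp_right fun h2 ↦ ⟨h2, ?_⟩⟩
      rwa [if_neg (by omega), if_neg (by omega)]
  · rintro (h | ⟨h1, h2 | ⟨h2, h3⟩⟩)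
    · exact .inl h
    · exact .inr ⟨h1.le, .inl h2⟩
    · refine .inr ⟨h1.le, .inr ⟨h2.le, ?_⟩⟩
      by_cases h0 : 𝓜.tieClass e = 0
      · rw [if_pos h0, if_pos (h2 ▸ h0)] at h3
        exact .inl ⟨h0.le, neg_lt_neg_iff.1 h3⟩
      · rw [if_neg h0, if_neg (h2 ▸ h0)] at h3
        exact .inr ⟨by omega, h3⟩

/-! ### The greedy loop. -/

/-- Put the unprocessed element with the least key into register `4`. -/
def select : Program :=
  .seq (.assign 4 (.reg 0)) (.for 3 0
    (.ite (.le (.get 5 (.reg 3)) (.lit 0))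
      (.ite (.or (.le (.reg 0) (.reg 4)) keyLt) (.assign 4 (.reg 3)) .skip) .skip))

lemma time_keyLt (env : Env) : keyLt.time env = 80 := by
  simp [keyLt, Test.or, Test.realLt, Test.time, classExpr, Expr.time]

variable {𝓜} in
theorem halts_select {τ : ℕ} {s : Memory} (hn : s.reg 0 = n) (h : 𝓜.IsClassified s.arr)
    (hs : ∃ e : Fin n, s.arr 5 e = 0) :
    Halts (𝓜.env pieces τ) select s (n * 109 + 9) fun s' ↦
      s'.arr = s.arr ∧ s'.reg 0 = n ∧ s'.reg 2 = s.reg 2 ∧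
        ∃ b : Fin n, s'.reg 4 = b ∧ s.arr 5 b = 0 ∧
          ∀ q : Fin n, s.arr 5 q = 0 → 𝓜.key b ≤ 𝓜.key q := by
  refine (Halts.seq (T := 2) (T' := n * 109 + 7) (Halts.assign ?_)).mono (by omega) fun _ h ↦ h
  -- The value `n` in register `4` is a sentinel: no unprocessed element has been met so far.
  refine (Halts.for (r := 3) (b := 0) (N := n) (T := 100) (by decide) (fun j s' ↦
    s'.arr = s.arr ∧ s'.reg 2 = s.reg 2 ∧
      ((s'.reg 4 = n ∧ ∀ q : Fin n, q < j → s.arr 5 q ≠ 0) ∨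
        ∃ b : Fin n, s'.reg 4 = b ∧ s.arr 5 b = 0 ∧
          ∀ q : Fin n, q < j → s.arr 5 q = 0 → 𝓜.key b ≤ 𝓜.key q))
    (by simp [Memory.setReg, hn]) ⟨by rfl, by simp [Memory.setReg],
      .inl ⟨by simp [Memory.setReg, Expr.eval, hn], by simp⟩⟩ ?_).mono (by omega) ?_
  · rintro j hj s' hr3 hr0 ⟨ha, hr2, hinv⟩
    have hlt : ∀ q : Fin n, (q : ℕ) < j + 1 → (q : ℕ) < j ∨ q = ⟨j, hj⟩ := fun q hq ↦
      (Nat.lt_succ_iff_lt_or_eq.1 hq).imp_right fun h ↦ Fin.ext h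
    have hcl : 𝓜.IsClassified s'.arr := ha ▸ h
    refine (Halts.ite (T := 92) (T' := 1) (fun hp ↦ ?_) fun hp ↦ ?_).mono
      (by simp [Test.time, Expr.time]) fun _ h ↦ h
    · replace hp : s.arr 5 j = 0 := by simpa [Test.Holds, Expr.eval, ha, hr3] using hp
      refine (Halts.ite (T := 2) (T' := 1) (fun ht ↦ ?_) fun ht ↦ ?_).mono
        (by simp [Test.or, Test.time, Expr.time, time_keyLt]) fun _ h ↦ h
      · refine Halts.assign ?_
        refine ⟨by simp [Memory.setReg, hr3], by simp [Memory.setReg, hr0],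
          ha, by simp [Memory.setReg, hr2],
          .inr ⟨⟨j, hj⟩, by simp [Memory.setReg, Expr.eval, hr3], hp, fun q hq hq0 ↦ ?_⟩⟩
        obtain hq | rfl := hlt q hq
        · obtain ⟨-, hall⟩ | ⟨b, hb, hb0, hmin⟩ := hinv
          · exact absurd hq0 (hall q hq)
          · rw [Test.holds_or, hcl.holds_keyLt (e := ⟨j, hj⟩) hr3 hb] at ht
            refine (ht.resolve_left ?_).le.trans (hmin q hq hq0)
            simp [Test.Holds, Expr.eval, hr0, hb]
        · exact le_rfl
      · obtain ⟨h4, -⟩ | ⟨b, hb, hb0, hmin⟩ := hinv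
        · simp [Test.Holds, Expr.eval, hr0, h4] at ht
        rw [Test.holds_or, hcl.holds_keyLt (e := ⟨j, hj⟩) hr3 hb, not_or, not_lt] at ht
        refine Halts.skip ⟨hr3, hr0, ha, by simp [Memory.setReg, hr2],
          .inr ⟨b, by simp [Memory.setReg, hb], hb0, fun q hq hq0 ↦ ?_⟩⟩
        obtain hq | rfl := hlt q hq
        · exact hmin q hq hq0
        · exact ht.2
    · replace hp : s.arr 5 j ≠ 0 := by
        simpa [Test.Holds, Expr.eval, ha, hr3, Nat.pos_iff_ne_zero] using hp
      refine Halts.skip ⟨hr3, hr0, ha, by simp [Memory.setReg, hr2], ?_⟩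
      refine hinv.imp (fun ⟨h4, hall⟩ ↦ ⟨by simp [Memory.setReg, h4], fun q hq ↦ ?_⟩)
        fun ⟨b, hb, hb0, hmin⟩ ↦ ⟨b, by simp [Memory.setReg, hb], hb0, fun q hq hq0 ↦ ?_⟩
      · obtain hq | rfl := hlt q hq
        · exact hall q hq
        · exact hp
      · obtain hq | rfl := hlt q hq
        · exact hmin q hq hq0
        · exact absurd hq0 hp
  · rintro s' ⟨hr0, ha, hr2, hinv⟩
    refine ⟨ha, hr0, hr2, ?_⟩
    obtain ⟨-, hall⟩ | ⟨b, hb, hb0, hmin⟩ := hinv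
    · obtain ⟨e, he⟩ := hs
      exact absurd he (hall e e.2)
    · exact ⟨b, hb, hb0, fun q ↦ hmin q q.2⟩

/-- Process the elements in the order of their keys, and put each one that is independent of those
selected before into array `2`. -/
def greedy : Program :=
  .for 2 0 (.seq select (.seq (.store 5 (.reg 4) (.lit 1)) (.seq (.store 2 (.reg 4) (.lit 1))
    (.ite (.query 2) .skip (.store 2 (.reg 4) (.lit 0))))))

variable {𝓜} in
theorem halts_greedy {τ : ℕ} {s : Memory} (hn : s.reg 0 = n) (h : 𝓜.IsClassified s.arr)
    (h2 : s.arr 2 = 0) (h5 : s.arr 5 = 0) :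
    Halts (𝓜.env pieces τ) greedy s (n * (n * 109 + τ + 40) + 7) fun s' ↦
      𝓜.matroid.IsLocallyMinimalBase 𝓜.key {e : Fin n | s'.arr 2 e ≠ 0} := by
  classical
  -- Counting the processed elements ensures that one is left in every round and none at the end.
  refine (Halts.for (r := 2) (b := 0) (N := n) (T := n * 109 + τ + 31) (by decide) (fun i s' ↦
    𝓜.IsClassified s'.arr ∧ (Finset.univ.filter fun e : Fin n ↦ s'.arr 5 e ≠ 0).card = i ∧
      𝓜.matroid.IsGreedyState 𝓜.key {e : Fin n | s'.arr 5 e ≠ 0} {e : Fin n | s'.arr 2 e ≠ 0})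
    hn ⟨h, by simp [Memory.setReg, h5], ?_⟩ ?_).mono le_rfl ?_
  · simpa [Memory.setReg, h2, h5] using Matroid.isGreedyState_empty 𝓜.matroid 𝓜.key
  · rintro i hi s hr2 hr0 ⟨hcl, hcard, hst⟩
    have hex : ∃ e : Fin n, s.arr 5 e = 0 := by
      by_contra! hall
      simp [hall] at hcard
      omega
    refine (Halts.seq (T' := τ + 15) ((halts_select hr0 hcl hex).mono le_rfl ?_)).mono
      (by omega) fun _ h ↦ h
    rintro s' ⟨ha, hr0', hr2', b, hb, hb0, hmin⟩
    have hbP : b ∉ {e : Fin n | s.arr 5 e ≠ 0} := by simpa using hb0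
    have hbS : s.arr 2 b = 0 := by_contra fun h ↦ hbP (hst.subset h)
    have hmin' : ∀ q ∉ {e : Fin n | s.arr 5 e ≠ 0}, 𝓜.key b ≤ 𝓜.key q := fun q hq ↦
      hmin q (by simpa using hq)
    have hP : {e : Fin n | Function.update (s.arr 5) b 1 e ≠ 0} =
        insert b {e : Fin n | s.arr 5 e ≠ 0} := by
      ext e
      by_cases he : e = b <;> simp [Function.update_apply, he, Fin.val_inj]
    have hS : {e : Fin n | Function.update (s.arr 2) b 1 e ≠ 0} =
        insert b {e : Fin n | s.arr 2 e ≠ 0} := by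
      ext e
      by_cases he : e = b <;> simp [Function.update_apply, he, Fin.val_inj]
    -- The element is inserted tentatively for the oracle call; as `b` was not selected before,
    -- resetting its entry restores the old selection.
    have hS' : Function.update (s.arr 2) b 0 = s.arr 2 := by
      rw [← hbS, Function.update_eq_self]
    have hcard' : (Finset.univ.filter fun e : Fin n ↦ Function.update (s.arr 5) b 1 e ≠ 0).card =
        i + 1 := by
      have : (Finset.univ.filter fun e : Fin n ↦ Function.update (s.arr 5) b 1 e ≠ 0) =
          insert b (Finset.univ.filter fun e : Fin n ↦ s.arr 5 e ≠ 0) := by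
        ext e
        by_cases he : e = b <;> simp [Function.update_apply, he, Fin.val_inj]
      rw [this, Finset.card_insert_of_notMem (by simpa using hb0), hcard]
    refine (Halts.seq (T := 3) (T' := τ + 10) (Halts.store ?_)).mono (by omega) fun _ h ↦ h
    refine (Halts.seq (T := 3) (T' := τ + 7) (Halts.store ?_)).mono (by omega) fun _ h ↦ h
    refine (Halts.ite (T := 1) (T' := 3) (fun hq ↦ Halts.skip ?_) fun hq ↦ Halts.store ?_).mono
      (by simp [Test.time, env]; omega) fun _ h ↦ h
    · replace hq : 𝓜.matroid.Indep (insert b {e : Fin n | s.arr 2 e ≠ 0}) := by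
        rw [← hS]
        simpa [Test.Holds, env, Memory.setArr, Expr.eval, ha, hb] using hq
      refine ⟨by simp [Memory.setArr, hr2', hr2], by simp [Memory.setArr, hr0'], ?_, ?_, ?_⟩
      · intro e
        simpa [Memory.setArr, Memory.setReg, ha] using hcl e
      · simpa [Memory.setArr, Memory.setReg, Expr.eval, ha, hb] using hcard'
      · have := hst.insert_of_indep hbP hmin' hq
        rw [← hP, ← hS] at this
        simpa [Memory.setArr, Memory.setReg, Expr.eval, ha, hb] using this
    · replace hq : ¬ 𝓜.matroid.Indep (insert b {e : Fin n | s.arr 2 e ≠ 0}) := by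
        rw [← hS]
        simpa [Test.Holds, env, Memory.setArr, Expr.eval, ha, hb] using hq
      refine ⟨by simp [Memory.setArr, hr2', hr2], by simp [Memory.setArr, hr0'], ?_, ?_, ?_⟩
      · intro e
        simpa [Memory.setArr, Memory.setReg, ha] using hcl e
      · simpa [Memory.setArr, Memory.setReg, Expr.eval, ha, hb] using hcard'
      · have := hst.insert_of_not_indep (𝓜.ground_eq ▸ Set.mem_univ b) hbP hmin' hq
        rw [← hP] at this
        simpa [Memory.setArr, Memory.setReg, Expr.eval, ha, hb, hS'] using this
  · rintro s' ⟨-, -, hcard, hst⟩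
    have hall : {e : Fin n | s'.arr 5 e ≠ 0} = Set.univ := by
      have := Finset.filter_card_eq (s := Finset.univ) (p := fun e : Fin n ↦ s'.arr 5 e ≠ 0)
        (by simpa using hcard)
      exact Set.eq_univ_of_forall fun e ↦ this e (Finset.mem_univ e)
    exact (hall ▸ hst).isLocallyMinimalBase

end WeightedUncertaintyMatroid

lemma Polynomial.eval_mono_nat (p : Polynomial ℕ) : Monotone fun x ↦ p.eval x := by
  intro x y hxy
  simp only [Polynomial.eval_eq_sum, Polynomial.sum]
  gcongr

theorem mainTheorem1 :
    ∃ P : Program, ∀ τ : Polynomial ℕ, ∃ p : Polynomial ℕ,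
      ∀ (n : ℕ) (𝓜 : WeightedUncertaintyMatroid (Fin n)) (pieces : List (Fin n × BddInterval)),
        𝓜.DescribedBy pieces →
        ∃ (s : Memory) (t : ℕ),
          Exec (𝓜.env pieces (τ.eval n)) P (initialMemory pieces) s t ∧
          t ≤ p.eval (n + pieces.length) ∧
          IsMWB 𝓜.matroid 𝓜.weight (s.output n) ∧
          ∃ Q : Finset (Fin n), 𝓜.IsMinCostCertificate Q ∧ 𝓜.Verifies Q (s.output n) := by
  refine ⟨.seq WeightedUncertaintyMatroid.classify WeightedUncertaintyMatroid.greedy, fun τ ↦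
    ⟨.X * .C 39 + .X * (.X * .C 109 + τ + .C 40) + .C 14, fun n 𝓜 pieces h ↦ ?_⟩⟩
  obtain ⟨s, t, hexec, ht, hs⟩ := Halts.seq <| (WeightedUncertaintyMatroid.halts_classify h
    (τ.eval n)).mono le_rfl fun s ⟨h0, hcl, h2, h5⟩ ↦
      WeightedUncertaintyMatroid.halts_greedy h0 hcl h2 h5
  refine ⟨s, t, hexec, ht.trans ?_,
    WeightedUncertaintyMatroid.exists_isMinCostCertificate_verifies ?_⟩
  -- Polynomials over `ℕ` are monotone, so both `n` and `pieces.length` may be replaced by their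
  -- sum.
  · have hτ : τ.eval n ≤ τ.eval (n + pieces.length) := τ.eval_mono_nat (Nat.le_add_right n pieces.length)
    have hmul : n * (n * 109 + τ.eval n + 40) ≤ (n + pieces.length) *
        ((n + pieces.length) * 109 + τ.eval (n + pieces.length) + 40) :=
      Nat.mul_le_mul (by omega) (by omega)
    simp only [Polynomial.eval_add, Polynomial.eval_mul, Polynomial.eval_X, Polynomial.eval_C]
    omega
  · have : ((s.output n : Finset (Fin n)) : Set (Fin n)) = {e : Fin n | s.arr 2 e ≠ 0} := by
      ext e; simp [Memory.output]
    rw [this]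
    exact hs.comp_monotone fun e f ↦ 𝓜.lex_le_of_key_le
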